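/- Let $\mathcal{H}$ and $\mathcal{G}$ be real Hilbert spaces, let $f:\mathcal{H}\to\mathbb{R}\cup\{+\infty\}$ and $g:\mathcal{G}\to\mathbb{R}\cup\{+\infty\}$ be proper, convex and lower semicontinuous, and let $L:\mathcal{H}\to\mathcal{G}$ be a bounded linear operator with adjoint $L^*$. Write $\partial$ for the subdifferential, $g^*(u)=\sup_{y\in\mathcal{G}}(\langle u,y\rangle-g(y))$ for the convex conjugate, and $\mathrm{prox}_{\gamma h}(v)=\operatorname{argmin}_{z}\bigl(h(z)+\tfrac{1}{2\gamma}\|v-z\|^2\bigr)$ for the proximal operator. Call $(x^\star,y^\star)\in\mathcal{H}\times\mathcal{G}$ a KKT point if $-L^*y^\star\in\partial f(x^\star)$ and $Lx^\star\in\partial g^*(y^\star)$, and assume that at least one KKT point exists. Let $\tau,\sigma>0$ and $0<\theta\le 1$ satisfy $$\sigma\tau\|L\|^2<\frac{4\theta(2-\theta)}{1-2\theta+9\theta^2-4\theta^3},$$ and, from an arbitrary initial point $(x^0,y^0)\in\mathcal{H}\times\mathcal{G}$, let $(x^k,y^k)_{k\ge 0}$ be generated by the Chambolle--Pock iteration $$x^{k+1}=\mathrm{prox}_{\tau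 f}\bigl(x^k-\tau L^*y^k\bigr),\qquad y^{k+1}=\mathrm{prox}_{\sigma g^*}\bigl(y^k+\sigma L\bigl(x^{k+1}+\theta(x^{k+1}-x^k)\bigr)\bigr)\qquad(k\ge 0).$$ Then there is a KKT point $(x^\star,y^\star)$ such that $(x^k,y^k)$ converges weakly to $(x^\star,y^\star)$ in $\mathcal{H}\times\mathcal{G}$. -/

import Mathlib

open scoped InnerProductSpace

namespace ChambollePock

section Functions

variable {E : Type*} [NormedAddCommGroup E] [InnerProductSpace ℝ E]

/-- An extended-real-valued function is proper if it never takes the value `-∞`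
(that is, it maps into `ℝ ∪ {+∞}`) and is finite at some point. -/
structure IsProper (f : E → EReal) : Prop where
  ne_bot : ∀ x, f x ≠ ⊥
  exists_ne_top : ∃ x, f x ≠ ⊤

/-- Convexity of an extended-real-valued function, with the convention `0 * (+∞) = 0`. -/
def IsConvex (f : E → EReal) : Prop :=
  ∀ x y : E, ∀ t : ℝ, 0 ≤ t → t ≤ 1 →
    f ((1 - t) • x + t • y) ≤ ((1 - t : ℝ) : EReal) * f x + (t : EReal) * f y

/-- The subdifferential of `f` at `x`. -/
def subdifferential (f : E → EReal) (x : E) : Set E :=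
  {u | ∀ y : E, f x + ((⟪u, y - x⟫_ℝ : ℝ) : EReal) ≤ f y}

/-- The convex conjugate of `f`. -/
noncomputable def conj (f : E → EReal) (u : E) : EReal :=
  ⨆ x : E, (((⟪u, x⟫_ℝ : ℝ) : EReal) - f x)

/-- The function `z ↦ f z + ‖x - z‖² / (2γ)` minimized by the proximal operator. -/
noncomputable def proxObjective (γ : ℝ) (f : E → EReal) (x z : E) : EReal :=
  f z + ((1 / (2 * γ) * ‖x - z‖ ^ 2 : ℝ) : EReal)

/-- The proximal operator of `γ f`: `prox γ f x` is the minimizer of `proxObjective γ f x`.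
On a Hilbert space, for `γ > 0` and `f` proper, convex and lower semicontinuous, there is exactly
one minimizer; if there is no minimizer the value is arbitrary. -/
noncomputable def prox (γ : ℝ) (f : E → EReal) (x : E) : E :=
  Classical.epsilon fun p : E => ∀ z : E, proxObjective γ f x p ≤ proxObjective γ f x z

end Functions

section PrimalDual

variable {H G : Type*}
  [NormedAddCommGroup H] [InnerProductSpace ℝ H] [CompleteSpace H]
  [NormedAddCommGroup G] [InnerProductSpace ℝ G] [CompleteSpace G]

/-- `(x, y)` is a KKT point of the saddle-point problem
`min_x max_y f x + ⟪L x, y⟫ - g* y`. -/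
structure IsKKTPoint (f : H → EReal) (g : G → EReal) (L : H →L[ℝ] G) (x : H) (y : G) : Prop where
  primal : -(ContinuousLinearMap.adjoint L y) ∈ subdifferential f x
  dual : L x ∈ subdifferential (conj g) y

/-- `(x k, y k)` is generated by the Chambolle--Pock iteration with step sizes `τ`, `σ` and
relaxation parameter `θ`; the initial point `(x 0, y 0)` is arbitrary. -/
structure IsChambollePockSequence (f : H → EReal) (g : G → EReal) (L : H →L[ℝ] G)
    (τ σ θ : ℝ) (x : ℕ → H) (y : ℕ → G) : Prop where
  primal_step : ∀ k, x (k + 1) = prox τ f (x k - τ • ContinuousLinearMap.adjoint L (y k))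
  dual_step : ∀ k,
    y (k + 1) = prox σ (conj g) (y k + σ • L (x (k + 1) + θ • (x (k + 1) - x k)))

end PrimalDual

/-- Weak convergence of a sequence in a normed space: convergence in the weak topology. -/
def WeaklyConvergesTo {E : Type*} [NormedAddCommGroup E] [NormedSpace ℝ E]
    (z : ℕ → E) (a : E) : Prop :=
  Filter.Tendsto (fun k => toWeakSpace ℝ E (z k)) Filter.atTop (nhds (toWeakSpace ℝ E a))

end ChambollePock

/-! Put q = (1 - θ)/2 and measure distances by `stepForm` with coupling c = 1 - q. Each prox step
provides a subgradient at the new iterate. The subgradient inequalities linking two consecutive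
iterates and a KKT point can be weighted so that all function values cancel; what is left
(`stepForm_descent`) says that the squared distance N to the KKT point drops by the squared
increment W, up to a cross term between successive increments. `cross_le` bounds that term by β
times the sum of the two values of W, and the step-size bound leaves room for β < 1/2
(`exists_descent_factor`). Hence N + βW decreases, the increments vanish and N converges, for every
KKT point (`tendsto_of_descent`).

The conclusion is Opial's argument. Bounded iterates have weak limits along ultrafilters; such
limits are KKT points because the increments vanish (`saddle_of_weak_limit`), and any two coincide
because the distances to both converge (`weak_limit_unique`). Agreement along all ultrafilters is
weak convergence. -/

open scoped InnerProductSpace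
open Filter Topology

namespace ChambollePock

/-! ### Conjugates, existence of the prox point, and its subgradient -/

section ConvexFunctions

variable {E : Type*} [NormedAddCommGroup E] [InnerProductSpace ℝ E]

theorem IsConvex.le_coe {f : E → EReal} (hf : IsConvex f) {x y : E} {r s t : ℝ}
    (hx : f x ≤ r) (hy : f y ≤ s) (h0 : 0 ≤ t) (h1 : t ≤ 1) :
    f ((1 - t) • x + t • y) ≤ (((1 - t) * r + t * s : ℝ) : EReal) := by
  refine (hf x y t h0 h1).trans ?_
  have h0' : (0 : EReal) ≤ (t : EReal) := by exact_mod_cast h0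
  have h1' : (0 : EReal) ≤ ((1 - t : ℝ) : EReal) := by
    exact_mod_cast (sub_nonneg.2 h1)
  rw [EReal.coe_add, EReal.coe_mul, EReal.coe_mul]
  exact add_le_add (mul_le_mul_of_nonneg_left hx h1') (mul_le_mul_of_nonneg_left hy h0')

theorem IsConvex.convex_sublevel {f : E → EReal} (hf : IsConvex f) (r : ℝ) :
    Convex ℝ {z | f z ≤ r} := by
  intro x hx y hy a b ha hb hab
  obtain rfl : a = 1 - b := by linarith
  have := hf.le_coe hx hy hb (by linarith)
  rw [show (1 - b) * r + b * r = r by ring] at this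
  exact this

theorem IsConvex.convex_epigraph {f : E → EReal} (hf : IsConvex f) :
    Convex ℝ {p : E × ℝ | f p.1 ≤ (p.2 : EReal)} := by
  intro x hx y hy a b ha hb hab
  obtain rfl : a = 1 - b := by linarith
  exact hf.le_coe hx hy hb (by linarith)

omit [InnerProductSpace ℝ E] in
theorem isClosed_sublevel {f : E → EReal} (hf : LowerSemicontinuous f) (r : ℝ) :
    IsClosed {z | f z ≤ r} :=
  hf.isClosed_preimage (r : EReal)

omit [InnerProductSpace ℝ E] in
theorem isClosed_real_epigraph {f : E → EReal} (hf : LowerSemicontinuous f) :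
    IsClosed {p : E × ℝ | f p.1 ≤ (p.2 : EReal)} := by
  have h := hf.isClosed_epigraph
  have hc : Continuous fun p : E × ℝ => ((p.1, (p.2 : EReal)) : E × EReal) :=
    continuous_fst.prodMk (continuous_coe_real_ereal.comp continuous_snd)
  exact h.preimage hc

omit [NormedAddCommGroup E] [InnerProductSpace ℝ E] in
theorem IsProper.exists_coe {f : E → EReal} (hf : IsProper f) :
    ∃ x, ∃ r : ℝ, f x = r := by
  obtain ⟨x, hx⟩ := hf.exists_ne_top
  exact ⟨x, (f x).toReal, (EReal.coe_toReal hx (hf.ne_bot x)).symm⟩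

omit [NormedAddCommGroup E] [InnerProductSpace ℝ E] in
theorem IsProper.eq_coe {f : E → EReal} (hf : IsProper f) {x : E} (hx : f x ≠ ⊤) :
    ∃ r : ℝ, f x = r :=
  ⟨(f x).toReal, (EReal.coe_toReal hx (hf.ne_bot x)).symm⟩

theorem coe_le_of_forall_coe {a : ℝ} {b : EReal} (hb : b ≠ ⊥) (h : ∀ r : ℝ, b = r → a ≤ r) :
    (a : EReal) ≤ b := by
  induction b with
  | bot => exact absurd rfl hb
  | top => exact le_top
  | coe r => exact_mod_cast h r rfl

theorem subgradient_le {f : E → EReal} {x y u : E} {r s : ℝ} (h : u ∈ subdifferential f x)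
    (hx : f x = r) (hy : f y = s) : r + ⟪u, y - x⟫_ℝ ≤ s := by
  have := h y
  rw [hx, hy] at this
  exact_mod_cast this

theorem ne_top_of_subgradient {f : E → EReal} (hf : IsProper f) {x u : E}
    (h : u ∈ subdifferential f x) : f x ≠ ⊤ := by
  intro hx
  obtain ⟨y, r, hy⟩ := hf.exists_coe
  have := h y
  rw [hx, hy, EReal.top_add_coe] at this
  exact absurd this (not_le.2 (EReal.coe_lt_top r))

/-- Separate a point one unit below the graph from the closed convex epigraph. The functional has
positive vertical component because the graph point lies directly above, so it can be solved for the
height. -/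
theorem exists_affine_minorant [CompleteSpace E] {f : E → EReal} (hf : IsProper f)
    (hc : IsConvex f) (hl : LowerSemicontinuous f) :
    ∃ (u : E) (α : ℝ), ∀ z, ((α + ⟪u, z⟫_ℝ : ℝ) : EReal) ≤ f z := by
  obtain ⟨x, r, hx⟩ := hf.exists_coe
  have hnot : ((x, r - 1) : E × ℝ) ∉ {p : E × ℝ | f p.1 ≤ (p.2 : EReal)} := by
    simp only [Set.mem_ofPred_eq, hx, not_le]
    exact_mod_cast sub_one_lt r
  obtain ⟨φ, m, h1, h2⟩ :=
    geometric_hahn_banach_point_closed hc.convex_epigraph (isClosed_real_epigraph hl) hnot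
  have hφ : ∀ z : E, ∀ s : ℝ, φ (z, s) = φ (z, 0) + s * φ (0, 1) := by
    intro z s
    rw [← smul_eq_mul, ← map_smul, ← map_add]
    simp
  have hxr := h2 (x, r) hx.le
  rw [hφ] at h1 hxr
  have hpos : 0 < φ (0, 1) := by linarith
  let ψ : E →L[ℝ] ℝ := φ.comp (ContinuousLinearMap.inl ℝ E ℝ)
  refine ⟨-((φ (0, 1))⁻¹ • (InnerProductSpace.toDual ℝ E).symm ψ), m / φ (0, 1), fun z => ?_⟩
  refine coe_le_of_forall_coe (hf.ne_bot z) fun s hs => ?_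
  have h := h2 (z, s) hs.le
  rw [hφ] at h
  rw [inner_neg_left, real_inner_smul_left, InnerProductSpace.toDual_symm_apply]
  have hψ : ψ z = φ (z, 0) := rfl
  rw [hψ, ← sub_eq_add_neg, inv_mul_eq_div, ← sub_div, div_le_iff₀ hpos]
  linarith

theorem conj_ne_bot {f : E → EReal} (hf : IsProper f) (u : E) : conj f u ≠ ⊥ := by
  obtain ⟨x, r, hx⟩ := hf.exists_coe
  have h : ((⟪u, x⟫_ℝ : ℝ) : EReal) - f x ≤ conj f u :=
    le_iSup (fun x : E => ((⟪u, x⟫_ℝ : ℝ) : EReal) - f x) x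
  rw [hx, ← EReal.coe_sub] at h
  exact ne_of_gt (lt_of_lt_of_le (EReal.bot_lt_coe _) h)

theorem isProper_conj [CompleteSpace E] {f : E → EReal} (hf : IsProper f)
    (hc : IsConvex f) (hl : LowerSemicontinuous f) : IsProper (conj f) := by
  refine ⟨conj_ne_bot hf, ?_⟩
  obtain ⟨u, α, h⟩ := exists_affine_minorant hf hc hl
  refine ⟨u, ne_of_lt (lt_of_le_of_lt (b := ((-α : ℝ) : EReal)) ?_ (EReal.coe_lt_top _))⟩
  refine iSup_le fun x => ?_
  have hx := h x
  have hb := hf.ne_bot x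
  induction hfx : f x with
  | bot => exact absurd hfx hb
  | top => simp
  | coe r =>
    rw [hfx] at hx
    have hx' : α + ⟪u, x⟫_ℝ ≤ r := by exact_mod_cast hx
    rw [← EReal.coe_sub]
    exact_mod_cast (by linarith : ⟪u, x⟫_ℝ - r ≤ -α)

theorem isConvex_conj {f : E → EReal} (hf : IsProper f) : IsConvex (conj f) := by
  intro u v t h0 h1
  refine iSup_le fun x => ?_
  have h0' : (0 : EReal) ≤ (t : EReal) := by exact_mod_cast h0
  have h1' : (0 : EReal) ≤ ((1 - t : ℝ) : EReal) := by
    exact_mod_cast (sub_nonneg.2 h1)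
  have hle : ∀ w, ((⟪w, x⟫_ℝ : ℝ) : EReal) - f x ≤ conj f w := fun w =>
    le_iSup (fun x : E => ((⟪w, x⟫_ℝ : ℝ) : EReal) - f x) x
  have hu := mul_le_mul_of_nonneg_left (hle u) h1'
  have hv := mul_le_mul_of_nonneg_left (hle v) h0'
  have hb := hf.ne_bot x
  refine le_trans ?_ (add_le_add hu hv)
  induction hfx : f x with
  | bot => exact absurd hfx hb
  | top => simp
  | coe r =>
    rw [← EReal.coe_sub, ← EReal.coe_sub, ← EReal.coe_sub, ← EReal.coe_mul, ← EReal.coe_mul,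
      ← EReal.coe_add, inner_add_left, real_inner_smul_left, real_inner_smul_left]
    exact_mod_cast (by ring_nf; rfl :
      (1 - t) * ⟪u, x⟫_ℝ + t * ⟪v, x⟫_ℝ - r ≤
        (1 - t) * (⟪u, x⟫_ℝ - r) + t * (⟪v, x⟫_ℝ - r))

theorem lowerSemicontinuous_conj {f : E → EReal} (hf : IsProper f) :
    LowerSemicontinuous (conj f) := by
  refine lowerSemicontinuous_iSup fun x => ?_
  have hb := hf.ne_bot x
  induction hfx : f x with
  | bot => exact absurd hfx hb
  | top => simpa using lowerSemicontinuous_const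
  | coe r =>
    have : Continuous fun u : E => ((⟪u, x⟫_ℝ - r : ℝ) : EReal) :=
      continuous_coe_real_ereal.comp (by fun_prop)
    simpa only [EReal.coe_sub] using this.lowerSemicontinuous

/-- Strong convexity of the quadratic makes a minimizing sequence Cauchy, so completeness suffices
and no weak compactness is needed. -/
theorem exists_proxObjective_minimizer [CompleteSpace E] {f : E → EReal} (hf : IsProper f)
    (hc : IsConvex f) (hl : LowerSemicontinuous f) {γ : ℝ} (hγ : 0 < γ) (x : E) :
    ∃ p, ∀ z, proxObjective γ f x p ≤ proxObjective γ f x z := by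
  obtain ⟨u, α, hu⟩ := exists_affine_minorant hf hc hl
  set c : ℝ := 1 / (2 * γ) with hc_def
  have hcpos : 0 < c := by positivity
  -- Real upper bounds of objective values: working with them keeps the infimum in `ℝ`.
  let S : Set ℝ := {r | ∃ z, f z ≤ ((r - c * ‖x - z‖ ^ 2 : ℝ) : EReal)}
  have hSne : S.Nonempty := by
    obtain ⟨z, r, hz⟩ := hf.exists_coe
    exact ⟨r + c * ‖x - z‖ ^ 2, z, by rw [hz]; exact_mod_cast (by linarith)⟩
  have hSbdd : BddBelow S := by
    refine ⟨α + ⟪u, x⟫_ℝ - ‖u‖ ^ 2 / (4 * c), ?_⟩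
    rintro r ⟨z, hz⟩
    have h1 : α + ⟪u, z⟫_ℝ ≤ r - c * ‖x - z‖ ^ 2 := by exact_mod_cast (hu z).trans hz
    have h2 : ⟪u, x - z⟫_ℝ ≤ ‖u‖ * ‖x - z‖ := real_inner_le_norm _ _
    rw [inner_sub_right] at h2
    have h3 : ‖u‖ * ‖x - z‖ ≤ c * ‖x - z‖ ^ 2 + ‖u‖ ^ 2 / (4 * c) := by
      have : c * ‖x - z‖ ^ 2 + ‖u‖ ^ 2 / (4 * c) - ‖u‖ * ‖x - z‖
          = c * (‖x - z‖ - ‖u‖ / (2 * c)) ^ 2 := by field_simp; ring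
      have := mul_nonneg hcpos.le (sq_nonneg (‖x - z‖ - ‖u‖ / (2 * c)))
      linarith
    linarith
  set m := sInf S with hm
  have hex : ∀ n : ℕ, ∃ z, f z ≤ ((m + 1 / ((n : ℝ) + 1) - c * ‖x - z‖ ^ 2 : ℝ) : EReal) := by
    intro n
    obtain ⟨r, ⟨z, hz⟩, hr⟩ := exists_lt_of_csInf_lt hSne
      (lt_add_of_pos_right m (Nat.one_div_pos_of_nat (α := ℝ) (n := n)))
    exact ⟨z, hz.trans (EReal.coe_le_coe_iff.2 (by linarith))⟩
  choose z hz using hex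
  have hdist : ∀ i j N : ℕ, N ≤ i → N ≤ j →
      dist (z i) (z j) ≤ √(4 / c * (1 / ((N : ℝ) + 1))) := by
    intro i j N hi hj
    apply Real.le_sqrt_of_sq_le
    have hmid := hc.le_coe (hz i) (hz j) (t := 1 / 2) (by norm_num) (by norm_num)
    set w := (1 - 1 / 2 : ℝ) • z i + (1 / 2 : ℝ) • z j with hw
    -- Parallelogram law: the midpoint gains c‖z i - z j‖²/4, yet its value is at least m.
    have hpar : ‖x - w‖ ^ 2 = ‖x - z i‖ ^ 2 / 2 + ‖x - z j‖ ^ 2 / 2 - ‖z i - z j‖ ^ 2 / 4 := by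
      have e1 : x - w = (1 / 2 : ℝ) • (x - z i) + (1 / 2 : ℝ) • (x - z j) := by
        rw [hw]; module
      have e2 : z i - z j = (x - z j) - (x - z i) := by abel
      rw [e1, e2, norm_add_sq_real, norm_sub_sq_real (x - z j), norm_smul, norm_smul,
        real_inner_smul_left, real_inner_smul_right, real_inner_comm (x - z i)]
      norm_num
      ring
    have hmem : (1 - 1 / 2) * (m + 1 / ((i : ℝ) + 1) - c * ‖x - z i‖ ^ 2)
        + 1 / 2 * (m + 1 / ((j : ℝ) + 1) - c * ‖x - z j‖ ^ 2) + c * ‖x - w‖ ^ 2 ∈ S :=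
      ⟨w, hmid.trans (by exact_mod_cast (by linarith))⟩
    have hle := csInf_le hSbdd hmem
    rw [← hm, hpar] at hle
    have hi' : 1 / ((i : ℝ) + 1) ≤ 1 / ((N : ℝ) + 1) := Nat.one_div_le_one_div hi
    have hj' : 1 / ((j : ℝ) + 1) ≤ 1 / ((N : ℝ) + 1) := Nat.one_div_le_one_div hj
    rw [dist_eq_norm, div_mul_eq_mul_div, le_div_iff₀ hcpos]
    linarith
  have hlim : Tendsto (fun N : ℕ => √(4 / c * (1 / ((N : ℝ) + 1)))) atTop (𝓝 0) := by
    have := ((tendsto_one_div_add_atTop_nhds_zero_nat (𝕜 := ℝ)).const_mul (4 / c)).sqrt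
    simpa using this
  obtain ⟨p, hp⟩ := cauchySeq_tendsto_of_complete (cauchySeq_of_le_tendsto_0 _ hdist hlim)
  have hval : f p ≤ ((m - c * ‖x - p‖ ^ 2 : ℝ) : EReal) := by
    have hconv : Tendsto (fun n : ℕ => m + 1 / ((n : ℝ) + 1) - c * ‖x - z n‖ ^ 2) atTop
        (𝓝 (m - c * ‖x - p‖ ^ 2)) := by
      have h1 := (tendsto_one_div_add_atTop_nhds_zero_nat (𝕜 := ℝ)).const_add m
      have h2 := ((hp.const_sub x).norm.pow 2).const_mul c
      simpa using h1.sub h2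
    refine EReal.le_of_forall_lt_iff_le.1 fun r hr => ?_
    have hr' : m - c * ‖x - p‖ ^ 2 < r := by exact_mod_cast hr
    refine (isClosed_sublevel hl r).mem_of_tendsto hp ?_
    filter_upwards [hconv.eventually_lt_const hr'] with n hn
    exact (hz n).trans (by exact_mod_cast hn.le)
  refine ⟨p, fun w => ?_⟩
  have hp_le : proxObjective γ f x p ≤ (m : EReal) := by
    have := add_le_add_left hval ((c * ‖x - p‖ ^ 2 : ℝ) : EReal)
    rw [← EReal.coe_add, sub_add_cancel] at this
    exact this
  refine hp_le.trans ?_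
  have hb := hf.ne_bot w
  unfold proxObjective
  induction hfw : f w with
  | bot => exact absurd hfw hb
  | top => rw [EReal.top_add_coe]; exact le_top
  | coe r =>
    rw [← EReal.coe_add]
    refine EReal.coe_le_coe_iff.2 (csInf_le hSbdd ⟨w, ?_⟩)
    rw [hfw]
    exact_mod_cast (by linarith)

/-- Compare p with the points (1 - t)p + tz, divide by t and let t tend to 0. -/
theorem subgradient_of_minimizer {f : E → EReal} (hf : IsProper f) (hc : IsConvex f)
    {γ : ℝ} (hγ : 0 < γ) {x p : E}
    (hp : ∀ z, proxObjective γ f x p ≤ proxObjective γ f x z) :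
    f p ≠ ⊤ ∧ γ⁻¹ • (x - p) ∈ subdifferential f p := by
  have hpt : f p ≠ ⊤ := by
    intro h
    obtain ⟨z, r, hz⟩ := hf.exists_coe
    have := hp z
    unfold proxObjective at this
    rw [h, hz, EReal.top_add_coe, ← EReal.coe_add] at this
    exact absurd this (not_le.2 (EReal.coe_lt_top _))
  refine ⟨hpt, fun z => ?_⟩
  obtain ⟨r, hr⟩ := hf.eq_coe hpt
  rw [hr, ← EReal.coe_add]
  refine coe_le_of_forall_coe (hf.ne_bot z) fun s hs => ?_
  set K := 1 / (2 * γ) * ‖z - p‖ ^ 2 with hK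
  have key : ∀ t : ℝ, 0 < t → t ≤ 1 → r + ⟪γ⁻¹ • (x - p), z - p⟫_ℝ ≤ s + t * K := by
    intro t h0 h1
    have h2 := hc.le_coe hr.le hs.le h0.le h1
    have h3 := (hp ((1 - t) • p + t • z)).trans (add_le_add_left h2 _)
    unfold proxObjective at h3
    rw [hr, ← EReal.coe_add, ← EReal.coe_add, EReal.coe_le_coe_iff] at h3
    have e : x - ((1 - t) • p + t • z) = (x - p) - t • (z - p) := by module
    rw [e, norm_sub_sq_real (x - p), real_inner_smul_right, norm_smul, mul_pow, Real.norm_eq_abs,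
      sq_abs] at h3
    rw [real_inner_smul_left]
    have h4 : t * (r + γ⁻¹ * ⟪x - p, z - p⟫_ℝ) ≤ t * (s + t * K) := by
      have e2 : 1 / (2 * γ) * (‖x - p‖ ^ 2 - 2 * (t * ⟪x - p, z - p⟫_ℝ) + t ^ 2 * ‖z - p‖ ^ 2)
          = 1 / (2 * γ) * ‖x - p‖ ^ 2 - t * (γ⁻¹ * ⟪x - p, z - p⟫_ℝ) + t * (t * K) := by
        rw [hK]; field_simp
      linarith
    exact le_of_mul_le_mul_left h4 h0
  have hcont : Tendsto (fun t : ℝ => s + t * K) (𝓝[>] 0) (𝓝 s) := by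
    have : Continuous fun t : ℝ => s + t * K := by fun_prop
    have h := this.tendsto 0
    simp only [zero_mul, add_zero] at h
    exact h.mono_left nhdsWithin_le_nhds
  refine ge_of_tendsto hcont ?_
  filter_upwards [Ioc_mem_nhdsGT (zero_lt_one' ℝ)] with t ht
  exact key t ht.1 ht.2

theorem prox_spec [CompleteSpace E] {f : E → EReal} (hf : IsProper f)
    (hc : IsConvex f) (hl : LowerSemicontinuous f) {γ : ℝ} (hγ : 0 < γ) (x : E) :
    f (prox γ f x) ≠ ⊤ ∧ γ⁻¹ • (x - prox γ f x) ∈ subdifferential f (prox γ f x) :=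
  subgradient_of_minimizer hf hc hγ
    (Classical.epsilon_spec (exists_proxObjective_minimizer hf hc hl hγ x))

end ConvexFunctions

/-! ### One-step descent and the cross-term bound -/

section StepForm

variable {H G : Type*}
  [NormedAddCommGroup H] [InnerProductSpace ℝ H] [CompleteSpace H]
  [NormedAddCommGroup G] [InnerProductSpace ℝ G] [CompleteSpace G]

/-- The symmetric bilinear form on `H × G` in which the iteration is Fejér monotone. -/
noncomputable def stepForm (L : H →L[ℝ] G) (τ σ c : ℝ) (a : H) (b : G) (a' : H) (b' : G) : ℝ :=
  τ⁻¹ * ⟪a, a'⟫_ℝ + σ⁻¹ * ⟪b, b'⟫_ℝ - c * (⟪L a, b'⟫_ℝ + ⟪L a', b⟫_ℝ)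

theorem stepForm_descent (L : H →L[ℝ] G) {τ σ θ q : ℝ} (hq : 2 * q = 1 - θ) (hq0 : 0 ≤ q)
    (hq1 : q ≤ 1)
    {x₀ x₁ x₂ xs : H} {y₀ y₁ y₂ ys : G} {f₁ f₂ fs g₁ g₂ gs : ℝ}
    (hf₁ : fs + ⟪-(ContinuousLinearMap.adjoint L ys), x₁ - xs⟫_ℝ ≤ f₁)
    (hf₂ : fs + ⟪-(ContinuousLinearMap.adjoint L ys), x₂ - xs⟫_ℝ ≤ f₂)
    (hfs : f₂ + ⟪τ⁻¹ • (x₁ - τ • ContinuousLinearMap.adjoint L y₁ - x₂), xs - x₂⟫_ℝ ≤ fs)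
    (hf₁₂ : f₁ + ⟪τ⁻¹ • (x₀ - τ • ContinuousLinearMap.adjoint L y₀ - x₁), x₂ - x₁⟫_ℝ ≤ f₂)
    (hg₁ : gs + ⟪L xs, y₁ - ys⟫_ℝ ≤ g₁) (hg₂ : gs + ⟪L xs, y₂ - ys⟫_ℝ ≤ g₂)
    (hgs : g₂ + ⟪σ⁻¹ • (y₁ + σ • L (x₂ + θ • (x₂ - x₁)) - y₂), ys - y₂⟫_ℝ ≤ gs)
    (hg₁₂ : g₁ + ⟪σ⁻¹ • (y₀ + σ • L (x₁ + θ • (x₁ - x₀)) - y₁), y₂ - y₁⟫_ℝ ≤ g₂)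
    (hτ : 0 < τ) (hσ : 0 < σ) :
    stepForm L τ σ (1 - q) (x₂ - xs) (y₂ - ys) (x₂ - xs) (y₂ - ys) ≤
      stepForm L τ σ (1 - q) (x₁ - xs) (y₁ - ys) (x₁ - xs) (y₁ - ys)
      - stepForm L τ σ (1 - q) (x₂ - x₁) (y₂ - y₁) (x₂ - x₁) (y₂ - y₁)
      + 2 * (q * stepForm L τ σ (1 - q) (x₁ - x₀) (y₁ - y₀) (x₂ - x₁) (y₂ - y₁)
        + q ^ 2 * (⟪L (x₁ - x₀), y₂ - y₁⟫_ℝ - ⟪L (x₂ - x₁), y₁ - y₀⟫_ℝ)) := by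
  obtain rfl : θ = 1 - 2 * q := by linarith
  -- Weights q, 1 - q, q, with weight 1 on `hfs` and `hgs`, make all values of f and g* cancel in
  -- the sum.
  have w1 := mul_le_mul_of_nonneg_left hf₁ hq0
  have w2 := mul_le_mul_of_nonneg_left hf₂ (sub_nonneg.2 hq1)
  have w3 := mul_le_mul_of_nonneg_left hf₁₂ hq0
  have v1 := mul_le_mul_of_nonneg_left hg₁ hq0
  have v2 := mul_le_mul_of_nonneg_left hg₂ (sub_nonneg.2 hq1)
  have v3 := mul_le_mul_of_nonneg_left hg₁₂ hq0
  simp only [stepForm, inner_sub_left, inner_sub_right, inner_add_right,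
    inner_neg_left, real_inner_smul_right, map_sub, map_add, map_smul,
    ContinuousLinearMap.adjoint_inner_left, ContinuousLinearMap.adjoint_inner_right,
    real_inner_comm, mul_sub, mul_add, inv_mul_cancel_left₀ hτ.ne',
    inv_mul_cancel_left₀ hσ.ne'] at *
  linarith

omit [CompleteSpace H] [CompleteSpace G] in
theorem two_mul_abs_inner_le (L : H →L[ℝ] G) {τ σ r : ℝ} (hτ : 0 < τ) (hσ : 0 < σ)
    (hr : 0 ≤ r) (hs : σ * τ * ‖L‖ ^ 2 ≤ r ^ 2) (a : H) (b : G) :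
    2 * |⟪L a, b⟫_ℝ| ≤ r * (τ⁻¹ * ‖a‖ ^ 2 + σ⁻¹ * ‖b‖ ^ 2) := by
  have h1 : |⟪L a, b⟫_ℝ| ≤ ‖L‖ * ‖a‖ * ‖b‖ :=
    (abs_real_inner_le_norm _ _).trans (by gcongr; exact L.le_opNorm a)
  have hst : 0 < √τ := Real.sqrt_pos.2 hτ
  have hss : 0 < √σ := Real.sqrt_pos.2 hσ
  have h2 : √σ * √τ * ‖L‖ ≤ r := by
    refine (sq_le_sq₀ (by positivity) hr).1 ?_
    rw [mul_pow, mul_pow, Real.sq_sqrt hτ.le, Real.sq_sqrt hσ.le]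
    exact hs
  have e1 : τ⁻¹ * ‖a‖ ^ 2 + σ⁻¹ * ‖b‖ ^ 2 = (‖a‖ / √τ) ^ 2 + (‖b‖ / √σ) ^ 2 := by
    rw [div_pow, div_pow, Real.sq_sqrt hτ.le, Real.sq_sqrt hσ.le]; ring
  have e2 : ‖L‖ * ‖a‖ * ‖b‖ = (√σ * √τ * ‖L‖) * ((‖a‖ / √τ) * (‖b‖ / √σ)) := by
    field_simp
  have h3 : (√σ * √τ * ‖L‖) * ((‖a‖ / √τ) * (‖b‖ / √σ)) ≤ r * ((‖a‖ / √τ) * (‖b‖ / √σ)) :=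
    mul_le_mul_of_nonneg_right h2 (by positivity)
  have h4 := mul_le_mul_of_nonneg_left (two_mul_le_add_sq (‖a‖ / √τ) (‖b‖ / √σ)) hr
  rw [e1]
  linarith

omit [CompleteSpace H] [CompleteSpace G] in
theorem inner_le_weighted (L : H →L[ℝ] G) {τ μ : ℝ} (hτ : 0 < τ) (hμ : 0 < μ) (e : H) (v : G) :
    2 * ⟪L e, v⟫_ℝ ≤ μ * (τ⁻¹ * ‖e‖ ^ 2) + τ * ‖L‖ ^ 2 / μ * ‖v‖ ^ 2 := by
  have h1 : ⟪L e, v⟫_ℝ ≤ ‖L‖ * ‖e‖ * ‖v‖ :=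
    (real_inner_le_norm _ _).trans (by gcongr; exact L.le_opNorm e)
  have h2 : μ * (τ⁻¹ * ‖e‖ ^ 2) + τ * ‖L‖ ^ 2 / μ * ‖v‖ ^ 2 - 2 * (‖L‖ * ‖e‖ * ‖v‖)
      = (μ * τ)⁻¹ * (μ * ‖e‖ - τ * ‖L‖ * ‖v‖) ^ 2 := by
    field_simp
    ring
  have h3 : 0 ≤ (μ * τ)⁻¹ * (μ * ‖e‖ - τ * ‖L‖ * ‖v‖) ^ 2 := by positivity
  linarith

omit [CompleteSpace H] [CompleteSpace G] in
-- In the sums and differences of the two increments, the symmetric part is diagonal with weights β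
-- - q and β + q, while the skew part pairs sums with differences. Young's inequality eliminates the
-- H-components, leaving a quadratic form in G.
theorem cross_le (L : H →L[ℝ] G) {τ σ c q β : ℝ} (hτ : 0 < τ) (hσ : 0 < σ)
    (hq : 0 ≤ q) (hβ : q < β)
    (h : σ * τ * ‖L‖ ^ 2 * q ^ 4 ≤ (1 - σ * τ * ‖L‖ ^ 2 * c ^ 2) * (β ^ 2 - q ^ 2))
    (a' a : H) (b' b : G) :
    2 * (q * stepForm L τ σ c a' b' a b + q ^ 2 * (⟪L a', b⟫_ℝ - ⟪L a, b'⟫_ℝ)) ≤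
      β * (stepForm L τ σ c a' b' a' b' + stepForm L τ σ c a b a b) := by
  have hm : 0 < β - q := by linarith
  have hp : 0 < β + q := by linarith
  have E := inner_le_weighted L hτ hm (a + a')
    ((c * (β - q)) • (b + b') + q ^ 2 • (b - b'))
  have F := inner_le_weighted L hτ hp (a - a')
    ((c * (β + q)) • (b - b') - q ^ 2 • (b + b'))
  -- The products of b + b' with b - b' cancel between the two terms; both remaining coefficients
  -- contain the slack of `h` as a factor.
  have hg : τ * ‖L‖ ^ 2 / (β - q) * ‖(c * (β - q)) • (b + b') + q ^ 2 • (b - b')‖ ^ 2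
      + τ * ‖L‖ ^ 2 / (β + q) * ‖(c * (β + q)) • (b - b') - q ^ 2 • (b + b')‖ ^ 2
      ≤ σ⁻¹ * ((β - q) * ‖b + b'‖ ^ 2 + (β + q) * ‖b - b'‖ ^ 2) := by
    rw [norm_add_sq_real, norm_sub_sq_real, norm_smul, norm_smul, norm_smul, norm_smul,
      real_inner_smul_left, real_inner_smul_left, real_inner_smul_right, real_inner_smul_right,
      real_inner_comm (b - b')]
    simp only [mul_pow, Real.norm_eq_abs, sq_abs]
    set A := ‖b + b'‖ ^ 2
    set B := ‖b - b'‖ ^ 2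
    have e : σ⁻¹ * ((β - q) * A + (β + q) * B) - (τ * ‖L‖ ^ 2 / (β - q) *
        (c ^ 2 * (β - q) ^ 2 * A + 2 * (c * (β - q) * (q ^ 2 * ⟪b - b', b + b'⟫_ℝ))
          + (q ^ 2) ^ 2 * B) + τ * ‖L‖ ^ 2 / (β + q) *
        (c ^ 2 * (β + q) ^ 2 * B - 2 * (c * (β + q) * (q ^ 2 * ⟪b - b', b + b'⟫_ℝ))
          + (q ^ 2) ^ 2 * A))
        = σ⁻¹ * ((1 - σ * τ * ‖L‖ ^ 2 * c ^ 2) * (β ^ 2 - q ^ 2) - σ * τ * ‖L‖ ^ 2 * q ^ 4)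
          * (A / (β + q) + B / (β - q)) := by
      field_simp
      ring
    have : 0 ≤ σ⁻¹ * ((1 - σ * τ * ‖L‖ ^ 2 * c ^ 2) * (β ^ 2 - q ^ 2) - σ * τ * ‖L‖ ^ 2 * q ^ 4)
          * (A / (β + q) + B / (β - q)) := by
      have := sub_nonneg.2 h
      positivity
    linarith
  have key := add_le_add (add_le_add E F) hg
  have key' : 2 * ⟪L (a + a'), (c * (β - q)) • (b + b') + q ^ 2 • (b - b')⟫_ℝ
      + 2 * ⟪L (a - a'), (c * (β + q)) • (b - b') - q ^ 2 • (b + b')⟫_ℝ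
      ≤ (β - q) * (τ⁻¹ * ‖a + a'‖ ^ 2) + (β + q) * (τ⁻¹ * ‖a - a'‖ ^ 2)
      + σ⁻¹ * ((β - q) * ‖b + b'‖ ^ 2 + (β + q) * ‖b - b'‖ ^ 2) := by linarith
  clear E F hg key h
  simp only [stepForm, ← real_inner_self_eq_norm_sq, inner_add_left, inner_add_right,
    inner_sub_left, inner_sub_right, map_add, map_sub, real_inner_smul_left,
    real_inner_comm] at key' ⊢
  linarith

end StepForm

/-! ### Weak limits along ultrafilters -/

section WeakLimits

variable {E : Type*} [NormedAddCommGroup E] [InnerProductSpace ℝ E] [CompleteSpace E]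

/-- Compactness of an interval gives a limit for each p; the limits form a bounded linear functional
of p, represented by Riesz. -/
theorem exists_weak_limit (U : Ultrafilter ℕ) {x : ℕ → E} {C : ℝ} (hC : ∀ k, ‖x k‖ ≤ C) :
    ∃ a : E, ∀ p, Tendsto (fun k => ⟪p, x k⟫_ℝ) U (𝓝 ⟪p, a⟫_ℝ) := by
  have hb : ∀ p k, ⟪p, x k⟫_ℝ ∈ Set.Icc (-(C * ‖p‖)) (C * ‖p‖) := by
    intro p k
    have h := abs_real_inner_le_norm p (x k)
    have h2 : ‖p‖ * ‖x k‖ ≤ C * ‖p‖ := by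
      rw [mul_comm]
      exact mul_le_mul_of_nonneg_right (hC k) (norm_nonneg _)
    exact abs_le.1 (h.trans h2)
  have hex : ∀ p, ∃ l ∈ Set.Icc (-(C * ‖p‖)) (C * ‖p‖),
      Tendsto (fun k => ⟪p, x k⟫_ℝ) U (𝓝 l) := by
    intro p
    obtain ⟨l, hl, h⟩ := isCompact_Icc.ultrafilter_le_nhds (U.map fun k => ⟪p, x k⟫_ℝ)
      (le_principal_iff.2 (Filter.mem_map.2 (Filter.univ_mem' (hb p))))
    exact ⟨l, hl, h⟩
  choose l hl hlim using hex
  let φ : E →ₗ[ℝ] ℝ :=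
    { toFun := l
      map_add' := fun p p' => tendsto_nhds_unique (hlim (p + p')) (by
        simpa only [inner_add_left] using (hlim p).add (hlim p'))
      map_smul' := fun c p => tendsto_nhds_unique (hlim (c • p)) (by
        simpa only [real_inner_smul_left, RingHom.id_apply, smul_eq_mul] using
          (hlim p).const_mul c) }
  let ψ : E →L[ℝ] ℝ := φ.mkContinuous C fun p => abs_le.2 (hl p)
  refine ⟨(InnerProductSpace.toDual ℝ E).symm ψ, fun p => ?_⟩
  rw [real_inner_comm, InnerProductSpace.toDual_symm_apply]
  exact hlim p

/-- Weak lower semicontinuity: a hyperplane separates a from the closed convex sublevel set at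
height A. -/
theorem eventually_lt_of_weak_limit {f : E → EReal} (hc : IsConvex f)
    (hl : LowerSemicontinuous f) {U : Ultrafilter ℕ} {x : ℕ → E} {a : E}
    (h : ∀ p, Tendsto (fun k => ⟪p, x k⟫_ℝ) U (𝓝 ⟪p, a⟫_ℝ)) {A : ℝ} (hA : (A : EReal) < f a) :
    ∀ᶠ k in (U : Filter ℕ), (A : EReal) < f (x k) := by
  obtain ⟨φ, m, h1, h2⟩ := geometric_hahn_banach_point_closed (hc.convex_sublevel A)
    (isClosed_sublevel hl A) (x := a) (not_le.2 hA)
  have ht := h ((InnerProductSpace.toDual ℝ E).symm φ)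
  simp only [InnerProductSpace.toDual_symm_apply] at ht
  filter_upwards [ht.eventually_lt_const h1] with k hk
  by_contra hcon
  exact lt_asymm hk (h2 _ (not_lt.1 hcon))

omit [CompleteSpace E] in
theorem tendsto_inner_zero_of_bounded {U : Filter ℕ} {e x : ℕ → E} {C : ℝ}
    (hC : ∀ k, ‖x k‖ ≤ C) (he : Tendsto e U (𝓝 0)) :
    Tendsto (fun k => ⟪e k, x k⟫_ℝ) U (𝓝 0) := by
  have h := he.norm.mul_const C
  rw [norm_zero, zero_mul] at h
  refine squeeze_zero_norm (fun k => ?_) h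
  exact (abs_real_inner_le_norm _ _).trans
    (mul_le_mul_of_nonneg_left (hC k) (norm_nonneg _))

end WeakLimits

/-! ### Weak limits satisfy the KKT conditions -/

section Demiclosedness

variable {H G : Type*}
  [NormedAddCommGroup H] [InnerProductSpace ℝ H] [CompleteSpace H]
  [NormedAddCommGroup G] [InnerProductSpace ℝ G] [CompleteSpace G]

/-- ⟪L (x k), y k⟫ need not converge when both factors converge only weakly, but it cancels when the
two subgradient inequalities are added. Testing the limit inequality with y' = b or x' = a then
separates the two conditions. -/
theorem saddle_of_weak_limit {f : H → EReal} {h : G → EReal} (L : H →L[ℝ] G)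
    (hf : IsProper f) (hfc : IsConvex f) (hfl : LowerSemicontinuous f)
    (hh : IsProper h) (hhc : IsConvex h) (hhl : LowerSemicontinuous h)
    {U : Ultrafilter ℕ} {x u : ℕ → H} {y v : ℕ → G} {a : H} {b : G} {C : ℝ}
    (hxC : ∀ k, ‖x k‖ ≤ C) (hyC : ∀ k, ‖y k‖ ≤ C)
    (hx : ∀ p, Tendsto (fun k => ⟪p, x k⟫_ℝ) U (𝓝 ⟪p, a⟫_ℝ))
    (hy : ∀ p, Tendsto (fun k => ⟪p, y k⟫_ℝ) U (𝓝 ⟪p, b⟫_ℝ))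
    (hu : ∀ k, u k ∈ subdifferential f (x k)) (hv : ∀ k, v k ∈ subdifferential h (y k))
    (hu0 : Tendsto (fun k => u k + ContinuousLinearMap.adjoint L (y k)) U (𝓝 0))
    (hv0 : Tendsto (fun k => v k - L (x k)) U (𝓝 0)) :
    -(ContinuousLinearMap.adjoint L b) ∈ subdifferential f a ∧ L a ∈ subdifferential h b := by
  have key : ∀ x' y' : _, ∀ r t A B : ℝ, f x' = r → h y' = t → (A : EReal) < f a →
      (B : EReal) < h b → A + B ≤ r + t - (⟪L a, y'⟫_ℝ - ⟪L x', b⟫_ℝ) := by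
    intro x' y' r t A B hr ht hA hB
    have h1 := eventually_lt_of_weak_limit hfc hfl hx hA
    have h2 := eventually_lt_of_weak_limit hhc hhl hy hB
    have l1 : Tendsto (fun k => ⟪u k + ContinuousLinearMap.adjoint L (y k), x' - x k⟫_ℝ) U
        (𝓝 0) := tendsto_inner_zero_of_bounded (C := ‖x'‖ + C)
          (fun k => (norm_sub_le _ _).trans (by gcongr; exact hxC k)) hu0
    have l2 : Tendsto (fun k => ⟪v k - L (x k), y' - y k⟫_ℝ) U
        (𝓝 0) := tendsto_inner_zero_of_bounded (C := ‖y'‖ + C)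
          (fun k => (norm_sub_le _ _).trans (by gcongr; exact hyC k)) hv0
    have l3 : Tendsto (fun k => ⟪L (x k), y'⟫_ℝ) U (𝓝 ⟪L a, y'⟫_ℝ) := by
      have := hx (ContinuousLinearMap.adjoint L y')
      simp only [ContinuousLinearMap.adjoint_inner_left] at this
      simpa only [real_inner_comm] using this
    have l4 := hy (L x')
    have lim := ((l1.add l2).add (l3.sub l4)).const_sub (r + t)
    rw [add_zero, zero_add] at lim
    refine ge_of_tendsto lim ?_
    filter_upwards [h1, h2] with k k1 k2
    obtain ⟨rk, hrk⟩ := hf.eq_coe (ne_top_of_subgradient hf (hu k))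
    obtain ⟨tk, htk⟩ := hh.eq_coe (ne_top_of_subgradient hh (hv k))
    have e1 := subgradient_le (hu k) hrk hr
    have e2 := subgradient_le (hv k) htk ht
    rw [hrk, EReal.coe_lt_coe_iff] at k1
    rw [htk, EReal.coe_lt_coe_iff] at k2
    simp only [inner_add_left, inner_sub_left, inner_sub_right,
      ContinuousLinearMap.adjoint_inner_left] at e1 e2 ⊢
    rw [real_inner_comm (L x') (y k), real_inner_comm (L (x k)) (y k)]
    linarith
  obtain ⟨x', r, hr⟩ := hf.exists_coe
  obtain ⟨y', t, ht⟩ := hh.exists_coe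
  have hfa : f a ≠ ⊤ := by
    intro htop
    obtain ⟨B, -, hB⟩ := EReal.lt_iff_exists_real_btwn.1 (bot_lt_iff_ne_bot.2 (hh.ne_bot b))
    -- If f a were infinite, A could be arbitrary; this choice exceeds the bound by 1.
    have := key x' y' r t (r + t - (⟪L a, y'⟫_ℝ - ⟪L x', b⟫_ℝ) - B + 1) B hr ht
      (by rw [htop]; exact EReal.coe_lt_top _) hB
    linarith
  have hhb : h b ≠ ⊤ := by
    intro htop
    obtain ⟨A, -, hA⟩ := EReal.lt_iff_exists_real_btwn.1 (bot_lt_iff_ne_bot.2 (hf.ne_bot a))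
    have := key x' y' r t A (r + t - (⟪L a, y'⟫_ℝ - ⟪L x', b⟫_ℝ) - A + 1) hr ht hA
      (by rw [htop]; exact EReal.coe_lt_top _)
    linarith
  obtain ⟨R, hR⟩ := hf.eq_coe hfa
  obtain ⟨T, hT⟩ := hh.eq_coe hhb
  have key2 : ∀ x' y' : _, ∀ r t : ℝ, f x' = r → h y' = t →
      R + T ≤ r + t - (⟪L a, y'⟫_ℝ - ⟪L x', b⟫_ℝ) := by
    intro x' y' r t hr ht
    refine le_of_forall_pos_le_add fun ε hε => ?_
    have := key x' y' r t (R - ε / 2) (T - ε / 2) hr ht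
      (by rw [hR]; exact_mod_cast (by linarith)) (by rw [hT]; exact_mod_cast (by linarith))
    linarith
  constructor
  · intro z
    rw [hR, ← EReal.coe_add]
    refine coe_le_of_forall_coe (hf.ne_bot z) fun s hs => ?_
    have := key2 z b s T hs hT
    simp only [inner_neg_left, inner_sub_right, ContinuousLinearMap.adjoint_inner_left]
    rw [real_inner_comm (L z) b, real_inner_comm (L a) b]
    linarith
  · intro w
    rw [hT, ← EReal.coe_add]
    refine coe_le_of_forall_coe (hh.ne_bot w) fun s hs => ?_
    have := key2 a w R s hR hs
    rw [inner_sub_right]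
    linarith

end Demiclosedness

/-! ### Lyapunov sequence and the step-size condition -/

section Lyapunov

theorem tendsto_of_descent {N W : ℕ → ℝ} {β : ℝ} (hβ0 : 0 ≤ β) (hβ : β < 1 / 2)
    (hN : ∀ k, 0 ≤ N k) (hW : ∀ k, 0 ≤ W k)
    (h : ∀ k, N (k + 1) ≤ N k - W (k + 1) + β * (W k + W (k + 1))) :
    Tendsto W atTop (𝓝 0) ∧ ∃ φ, Tendsto N atTop (𝓝 φ) := by
  set V : ℕ → ℝ := fun k => N k + β * W k with hV
  have hstep : ∀ k, (1 - 2 * β) * W (k + 1) ≤ V k - V (k + 1) := fun k => by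
    have := h k
    simp only [hV]
    linarith
  have hpos : 0 < 1 - 2 * β := by linarith
  have hanti : Antitone V := antitone_nat_of_succ_le fun k => by
    have := mul_nonneg hpos.le (hW (k + 1))
    linarith [hstep k]
  have hbdd : BddBelow (Set.range V) := ⟨0, by
    rintro _ ⟨k, rfl⟩
    exact add_nonneg (hN k) (mul_nonneg hβ0 (hW k))⟩
  have hVlim := tendsto_atTop_ciInf hanti hbdd
  have hdiff := hVlim.sub (hVlim.comp (tendsto_add_atTop_nat 1))
  rw [sub_self] at hdiff
  have hW1 : Tendsto (fun k => W (k + 1)) atTop (𝓝 0) := by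
    have hd := hdiff.const_mul (1 - 2 * β)⁻¹
    rw [mul_zero] at hd
    refine squeeze_zero (fun k => hW _) (fun k => ?_) hd
    rw [inv_mul_eq_div, le_div_iff₀ hpos, mul_comm]
    exact hstep k
  have hW0 : Tendsto W atTop (𝓝 0) := (tendsto_add_atTop_iff_nat 1).1 hW1
  refine ⟨hW0, (⨅ k, V k) - β * 0, ?_⟩
  have := hVlim.sub (hW0.const_mul β)
  simpa only [hV, add_sub_cancel_right] using this

/-- With θ = 1 - 2q the step-size bound becomes the last inequality, strictly, at β = 1/2, so a
slightly smaller β still works. -/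
theorem exists_descent_factor {s θ q : ℝ} (hq : 2 * q = 1 - θ) (hs : 0 ≤ s) (hθ : 0 < θ)
    (hθ1 : θ ≤ 1)
    (h : s < 4 * θ * (2 - θ) / (1 - 2 * θ + 9 * θ ^ 2 - 4 * θ ^ 3)) :
    s * (1 - q) ^ 2 < 1 ∧ ∃ β, q < β ∧ β < 1 / 2 ∧
      s * q ^ 4 ≤ (1 - s * (1 - q) ^ 2) * (β ^ 2 - q ^ 2) := by
  obtain rfl : θ = 1 - 2 * q := by linarith
  have hq0 : 0 ≤ q := by linarith
  have hP : 0 < 1 / 4 - q ^ 2 := by nlinarith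
  have hD : 1 - 2 * (1 - 2 * q) + 9 * (1 - 2 * q) ^ 2 - 4 * (1 - 2 * q) ^ 3
      = 16 * ((1 - q) ^ 2 * (1 / 4 - q ^ 2) + q ^ 4) := by ring
  have hDpos : 0 < (1 - q) ^ 2 * (1 / 4 - q ^ 2) + q ^ 4 := by
    have : 0 < 1 - q := by linarith
    positivity
  rw [hD, lt_div_iff₀ (by linarith)] at h
  have h' : s * q ^ 4 < (1 - s * (1 - q) ^ 2) * (1 / 4 - q ^ 2) := by linarith
  have hsq : 0 ≤ s * q ^ 4 := by positivity
  have hM : 0 < 1 - s * (1 - q) ^ 2 := pos_of_mul_pos_left (hsq.trans_lt h') hP.le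
  refine ⟨by linarith, ?_⟩
  set T := s * q ^ 4 / (1 - s * (1 - q) ^ 2) with hT
  have hT0 : 0 ≤ T := by positivity
  have hT1 : T < 1 / 4 - q ^ 2 := by rw [hT, div_lt_iff₀' hM]; exact h'
  have hsqrt : √(q ^ 2 + (T + (1 / 4 - q ^ 2)) / 2) ^ 2 = q ^ 2 + (T + (1 / 4 - q ^ 2)) / 2 :=
    Real.sq_sqrt (by positivity)
  -- β² is the midpoint of q² + T, the least admissible value, and 1/4.
  refine ⟨√(q ^ 2 + (T + (1 / 4 - q ^ 2)) / 2), ?_, ?_, ?_⟩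
  · exact Real.lt_sqrt_of_sq_lt (by linarith)
  · rw [Real.sqrt_lt' (by norm_num)]
    linarith
  · rw [hsqrt, ← div_le_iff₀' hM]
    linarith

end Lyapunov

/-! ### Coercivity of the form -/

section StepFormCoercive

variable {H G : Type*}
  [NormedAddCommGroup H] [InnerProductSpace ℝ H]
  [NormedAddCommGroup G] [InnerProductSpace ℝ G]

theorem stepForm_coercive (L : H →L[ℝ] G) {τ σ c : ℝ} (hτ : 0 < τ) (hσ : 0 < σ) (hc : 0 ≤ c)
    (h : σ * τ * ‖L‖ ^ 2 * c ^ 2 < 1) :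
    ∃ δ > 0, ∀ a b, δ * (‖a‖ ^ 2 + ‖b‖ ^ 2) ≤ stepForm L τ σ c a b a b := by
  set s := σ * τ * ‖L‖ ^ 2 with hs
  have hs0 : 0 ≤ s := by positivity
  have hr : c * √s < 1 := by
    refine lt_of_pow_lt_pow_left₀ 2 zero_le_one ?_
    rw [mul_pow, Real.sq_sqrt hs0]
    linarith
  have hpos : 0 < 1 - c * √s := by linarith
  refine ⟨(1 - c * √s) * min τ⁻¹ σ⁻¹, by positivity, fun a b => ?_⟩
  have h1 := two_mul_abs_inner_le L hτ hσ (Real.sqrt_nonneg s) (Real.sq_sqrt hs0).ge a b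
  have h2 := mul_le_mul_of_nonneg_left ((mul_le_mul_of_nonneg_left
    (le_abs_self ⟪L a, b⟫_ℝ) zero_le_two).trans h1) hc
  have h3 : (1 - c * √s) * (min τ⁻¹ σ⁻¹ * (‖a‖ ^ 2 + ‖b‖ ^ 2))
      ≤ (1 - c * √s) * (τ⁻¹ * ‖a‖ ^ 2 + σ⁻¹ * ‖b‖ ^ 2) := by
    rw [mul_add (min τ⁻¹ σ⁻¹)]
    gcongr
    · exact min_le_left _ _
    · exact min_le_right _ _
  simp only [stepForm, real_inner_self_eq_norm_sq]
  linarith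

end StepFormCoercive

/-! ### Fejér monotonicity and Opial's argument -/

section Convergence

variable {H G : Type*}
  [NormedAddCommGroup H] [InnerProductSpace ℝ H] [CompleteSpace H]
  [NormedAddCommGroup G] [InnerProductSpace ℝ G] [CompleteSpace G]

theorem tendsto_stepForm {L : H →L[ℝ] G} {τ σ c : ℝ} {U : Filter ℕ} {x : ℕ → H} {y : ℕ → G}
    {a : H} {b : G} (hx : ∀ p, Tendsto (fun k => ⟪p, x k⟫_ℝ) U (𝓝 ⟪p, a⟫_ℝ))
    (hy : ∀ p, Tendsto (fun k => ⟪p, y k⟫_ℝ) U (𝓝 ⟪p, b⟫_ℝ)) (d : H) (e : G) :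
    Tendsto (fun k => stepForm L τ σ c d e (x k) (y k)) U (𝓝 (stepForm L τ σ c d e a b)) := by
  have h := hx (ContinuousLinearMap.adjoint L e)
  simp only [ContinuousLinearMap.adjoint_inner_left] at h
  simp only [stepForm, real_inner_comm e (L _)]
  exact (((hx d).const_mul _).add ((hy e).const_mul _)).sub
    (((hy (L d)).add h).const_mul _)

omit [CompleteSpace H] [CompleteSpace G] in
-- The quadratic terms in (x, y) cancel, so this difference passes to weak limits.
theorem stepForm_sub_sub (L : H →L[ℝ] G) (τ σ c : ℝ) (x a a' : H) (y b b' : G) :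
    stepForm L τ σ c (x - a) (y - b) (x - a) (y - b)
      - stepForm L τ σ c (x - a') (y - b') (x - a') (y - b')
      = stepForm L τ σ c a b a b - stepForm L τ σ c a' b' a' b'
        - 2 * stepForm L τ σ c (a - a') (b - b') x y := by
  simp only [stepForm, inner_sub_left, inner_sub_right, map_sub, real_inner_comm]
  ring

theorem weak_limit_unique {L : H →L[ℝ] G} {τ σ c δ : ℝ} (hδ : 0 < δ)
    (hN : ∀ a b, δ * (‖a‖ ^ 2 + ‖b‖ ^ 2) ≤ stepForm L τ σ c a b a b)
    {U U' : Ultrafilter ℕ} (hU : (U : Filter ℕ) ≤ atTop) (hU' : (U' : Filter ℕ) ≤ atTop)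
    {x : ℕ → H} {y : ℕ → G} {a a' : H} {b b' : G} {φ φ' : ℝ}
    (hx : ∀ p, Tendsto (fun k => ⟪p, x k⟫_ℝ) U (𝓝 ⟪p, a⟫_ℝ))
    (hy : ∀ p, Tendsto (fun k => ⟪p, y k⟫_ℝ) U (𝓝 ⟪p, b⟫_ℝ))
    (hx' : ∀ p, Tendsto (fun k => ⟪p, x k⟫_ℝ) U' (𝓝 ⟪p, a'⟫_ℝ))
    (hy' : ∀ p, Tendsto (fun k => ⟪p, y k⟫_ℝ) U' (𝓝 ⟪p, b'⟫_ℝ))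
    (hφ : Tendsto (fun k => stepForm L τ σ c (x k - a) (y k - b) (x k - a) (y k - b)) atTop
      (𝓝 φ))
    (hφ' : Tendsto (fun k => stepForm L τ σ c (x k - a') (y k - b') (x k - a') (y k - b')) atTop
      (𝓝 φ')) : a = a' ∧ b = b' := by
  have hdiff := hφ.sub hφ'
  simp only [stepForm_sub_sub] at hdiff
  -- The two limits of the same convergent sequence force the pairings of (a - a', b - b') with (a,
  -- b) and (a', b') to be equal, so this difference has zero form.
  have e1 := tendsto_nhds_unique (hdiff.mono_left hU)
    (((tendsto_stepForm hx hy (a - a') (b - b')).const_mul 2).const_sub _)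
  have e2 := tendsto_nhds_unique (hdiff.mono_left hU')
    (((tendsto_stepForm hx' hy' (a - a') (b - b')).const_mul 2).const_sub _)
  have e3 : stepForm L τ σ c (a - a') (b - b') (a - a') (b - b')
      = stepForm L τ σ c (a - a') (b - b') a b - stepForm L τ σ c (a - a') (b - b') a' b' := by
    simp only [stepForm, inner_sub_left, inner_sub_right, map_sub]
    ring
  have h0 := hN (a - a') (b - b')
  have h1 : ‖a - a'‖ ^ 2 + ‖b - b'‖ ^ 2 ≤ 0 := by
    by_contra! hcon
    have := mul_pos hδ hcon
    linarith
  constructor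
  · rw [← sub_eq_zero, ← norm_eq_zero, ← sq_eq_zero_iff]
    linarith [sq_nonneg ‖a - a'‖, sq_nonneg ‖b - b'‖]
  · rw [← sub_eq_zero, ← norm_eq_zero, ← sq_eq_zero_iff]
    linarith [sq_nonneg ‖a - a'‖, sq_nonneg ‖b - b'‖]

theorem weaklyConvergesTo_prod {x : ℕ → H} {y : ℕ → G} {a : H} {b : G}
    (hx : ∀ p, Tendsto (fun k => ⟪p, x k⟫_ℝ) atTop (𝓝 ⟪p, a⟫_ℝ))
    (hy : ∀ p, Tendsto (fun k => ⟪p, y k⟫_ℝ) atTop (𝓝 ⟪p, b⟫_ℝ)) :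
    WeaklyConvergesTo (fun k => (WithLp.toLp 2 (x k, y k) : WithLp 2 (H × G)))
      (WithLp.toLp 2 (a, b)) := by
  refine (WeakBilin.tendsto_iff_forall_eval_tendsto _ ?_).2 fun φ => ?_
  · intro z z' hzz
    exact (SeparatingDual.eq_iff_forall_dual_eq (R := ℝ)).2 fun φ => DFunLike.congr_fun hzz φ
  · have h : ∀ z : WithLp 2 (H × G), φ z
        = ⟪((InnerProductSpace.toDual ℝ _).symm φ).ofLp.1, z.ofLp.1⟫_ℝ
          + ⟪((InnerProductSpace.toDual ℝ _).symm φ).ofLp.2, z.ofLp.2⟫_ℝ := fun z => by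
      rw [← WithLp.prod_inner_apply, InnerProductSpace.toDual_symm_apply]
    change Tendsto (fun k => φ (WithLp.toLp 2 (x k, y k))) atTop (𝓝 (φ (WithLp.toLp 2 (a, b))))
    simp only [h]
    exact (hx _).add (hy _)

omit [CompleteSpace H] [CompleteSpace G] in
theorem bounded_of_tendsto_stepForm {L : H →L[ℝ] G} {τ σ c δ φ : ℝ} (hδ : 0 < δ)
    (hN : ∀ a b, δ * (‖a‖ ^ 2 + ‖b‖ ^ 2) ≤ stepForm L τ σ c a b a b)
    {x : ℕ → H} {y : ℕ → G} {a : H} {b : G}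
    (hφ : Tendsto (fun k => stepForm L τ σ c (x k - a) (y k - b) (x k - a) (y k - b)) atTop
      (𝓝 φ)) : ∃ C, (∀ k, ‖x k‖ ≤ C) ∧ ∀ k, ‖y k‖ ≤ C := by
  obtain ⟨M, hM⟩ := hφ.bddAbove_range
  have hk : ∀ k, ‖x k - a‖ ^ 2 + ‖y k - b‖ ^ 2 ≤ M / δ := fun k => by
    rw [le_div_iff₀' hδ]
    exact (hN _ _).trans (hM ⟨k, rfl⟩)
  have hx : ∀ k, ‖x k - a‖ ≤ √(M / δ) := fun k =>
    Real.le_sqrt_of_sq_le (by linarith [hk k, sq_nonneg ‖y k - b‖])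
  have hy : ∀ k, ‖y k - b‖ ≤ √(M / δ) := fun k =>
    Real.le_sqrt_of_sq_le (by linarith [hk k, sq_nonneg ‖x k - a‖])
  refine ⟨√(M / δ) + ‖a‖ + ‖b‖, fun k => ?_, fun k => ?_⟩
  · linarith [norm_le_norm_sub_add (x k) a, hx k, norm_nonneg b]
  · linarith [norm_le_norm_sub_add (y k) b, hy k, norm_nonneg a]

omit [CompleteSpace H] [CompleteSpace G] in
theorem tendsto_zero_of_stepForm {L : H →L[ℝ] G} {τ σ c δ : ℝ} (hδ : 0 < δ)
    (hN : ∀ a b, δ * (‖a‖ ^ 2 + ‖b‖ ^ 2) ≤ stepForm L τ σ c a b a b)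
    {a : ℕ → H} {b : ℕ → G}
    (h : Tendsto (fun k => stepForm L τ σ c (a k) (b k) (a k) (b k)) atTop (𝓝 0)) :
    Tendsto a atTop (𝓝 0) ∧ Tendsto b atTop (𝓝 0) := by
  have hs := (h.div_const δ).sqrt
  rw [zero_div, Real.sqrt_zero] at hs
  have hk : ∀ k, ‖a k‖ ^ 2 + ‖b k‖ ^ 2 ≤ stepForm L τ σ c (a k) (b k) (a k) (b k) / δ :=
    fun k => by
      rw [le_div_iff₀' hδ]
      exact hN _ _
  exact ⟨squeeze_zero_norm (fun k => Real.le_sqrt_of_sq_le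
      (by linarith [hk k, sq_nonneg ‖b k‖])) hs,
    squeeze_zero_norm (fun k => Real.le_sqrt_of_sq_le
      (by linarith [hk k, sq_nonneg ‖a k‖])) hs⟩

theorem IsChambollePockSequence.primal_subgradient {f : H → EReal} {g : G → EReal}
    {L : H →L[ℝ] G} {τ σ θ : ℝ} {x : ℕ → H} {y : ℕ → G}
    (hxy : IsChambollePockSequence f g L τ σ θ x y)
    (hf : IsProper f) (hfc : IsConvex f) (hfl : LowerSemicontinuous f) (hτ : 0 < τ) (k : ℕ) :
    τ⁻¹ • (x k - τ • ContinuousLinearMap.adjoint L (y k) - x (k + 1)) ∈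
      subdifferential f (x (k + 1)) := by
  rw [hxy.primal_step k]
  exact (prox_spec hf hfc hfl hτ _).2

theorem IsChambollePockSequence.dual_subgradient {f : H → EReal} {g : G → EReal}
    {L : H →L[ℝ] G} {τ σ θ : ℝ} {x : ℕ → H} {y : ℕ → G}
    (hxy : IsChambollePockSequence f g L τ σ θ x y)
    (hg : IsProper g) (hgc : IsConvex g) (hgl : LowerSemicontinuous g) (hσ : 0 < σ) (k : ℕ) :
    σ⁻¹ • (y k + σ • L (x (k + 1) + θ • (x (k + 1) - x k)) - y (k + 1)) ∈
      subdifferential (conj g) (y (k + 1)) := by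
  rw [hxy.dual_step k]
  exact (prox_spec (isProper_conj hg hgc hgl) (isConvex_conj hg)
    (lowerSemicontinuous_conj hg) hσ _).2

/-- The one-step residuals of the iteration tend to zero and the distance to every KKT point,
measured by `stepForm`, converges. -/
theorem IsChambollePockSequence.fejer {f : H → EReal} {g : G → EReal} {L : H →L[ℝ] G}
    {τ σ θ : ℝ} {x : ℕ → H} {y : ℕ → G} (hxy : IsChambollePockSequence f g L τ σ θ x y)
    (hf : IsProper f) (hfc : IsConvex f) (hfl : LowerSemicontinuous f)
    (hg : IsProper g) (hgc : IsConvex g) (hgl : LowerSemicontinuous g)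
    (hτ : 0 < τ) (hσ : 0 < σ) {q β δ : ℝ} (hq : 2 * q = 1 - θ) (hq0 : 0 ≤ q) (hq1 : q ≤ 1)
    (hqβ : q < β) (hβ : β < 1 / 2)
    (h : σ * τ * ‖L‖ ^ 2 * q ^ 4 ≤
      (1 - σ * τ * ‖L‖ ^ 2 * (1 - q) ^ 2) * (β ^ 2 - q ^ 2)) (hδ : 0 < δ)
    (hN : ∀ a b, δ * (‖a‖ ^ 2 + ‖b‖ ^ 2) ≤ stepForm L τ σ (1 - q) a b a b)
    {xs : H} {ys : G} (hs : IsKKTPoint f g L xs ys) :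
    Tendsto (fun k => stepForm L τ σ (1 - q) (x (k + 1) - x k) (y (k + 1) - y k)
      (x (k + 1) - x k) (y (k + 1) - y k)) atTop (𝓝 0) ∧
    ∃ φ, Tendsto (fun k => stepForm L τ σ (1 - q) (x k - xs) (y k - ys) (x k - xs) (y k - ys))
      atTop (𝓝 φ) := by
  have hN0 : ∀ a b, 0 ≤ stepForm L τ σ (1 - q) a b a b := fun a b =>
    (by positivity : (0 : ℝ) ≤ δ * (‖a‖ ^ 2 + ‖b‖ ^ 2)).trans (hN a b)
  have hg' := isProper_conj hg hgc hgl
  obtain ⟨fs, hfs⟩ := hf.eq_coe (ne_top_of_subgradient hf hs.primal)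
  obtain ⟨gs, hgs⟩ := hg'.eq_coe (ne_top_of_subgradient hg' hs.dual)
  have hu := hxy.primal_subgradient hf hfc hfl hτ
  have hv := hxy.dual_subgradient hg hgc hgl hσ
  choose F hF using fun k => hf.eq_coe (ne_top_of_subgradient hf (hu k))
  choose Γ hΓ using fun k => hg'.eq_coe (ne_top_of_subgradient hg' (hv k))
  -- N starts at index 1: the descent uses a subgradient at its base point, and the arbitrary
  -- initial point has none.
  obtain ⟨hW, φ, hφ⟩ := tendsto_of_descent (hq0.trans hqβ.le) hβ
    (N := fun k => stepForm L τ σ (1 - q) (x (k + 1) - xs) (y (k + 1) - ys)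
      (x (k + 1) - xs) (y (k + 1) - ys))
    (W := fun k => stepForm L τ σ (1 - q) (x (k + 1) - x k) (y (k + 1) - y k)
      (x (k + 1) - x k) (y (k + 1) - y k)) (fun k => hN0 _ _) (fun k => hN0 _ _) (fun k => by
      have d := stepForm_descent L hq hq0 hq1
        (subgradient_le hs.primal hfs (hF k)) (subgradient_le hs.primal hfs (hF (k + 1)))
        (subgradient_le (hu (k + 1)) (hF (k + 1)) hfs)
        (subgradient_le (hu k) (hF k) (hF (k + 1)))
        (subgradient_le hs.dual hgs (hΓ k)) (subgradient_le hs.dual hgs (hΓ (k + 1)))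
        (subgradient_le (hv (k + 1)) (hΓ (k + 1)) hgs)
        (subgradient_le (hv k) (hΓ k) (hΓ (k + 1))) hτ hσ
      have e := cross_le L hτ hσ hq0 hqβ h (x (k + 1) - x k) (x (k + 1 + 1) - x (k + 1))
        (y (k + 1) - y k) (y (k + 1 + 1) - y (k + 1))
      linarith)
  exact ⟨hW, φ, (tendsto_add_atTop_iff_nat 1).1 hφ⟩

theorem tendsto_inner_succ {E : Type*} [NormedAddCommGroup E] [InnerProductSpace ℝ E]
    {U : Filter ℕ} (hU : U ≤ atTop) {x : ℕ → E} {a : E}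
    (hdx : Tendsto (fun k => x (k + 1) - x k) atTop (𝓝 0))
    (hx : ∀ p, Tendsto (fun k => ⟪p, x k⟫_ℝ) U (𝓝 ⟪p, a⟫_ℝ)) (p : E) :
    Tendsto (fun k => ⟪p, x (k + 1)⟫_ℝ) U (𝓝 ⟪p, a⟫_ℝ) := by
  have h := (hx p).add ((tendsto_const_nhds (x := p)).inner (𝕜 := ℝ) (hdx.mono_left hU))
  simpa only [← inner_add_right, add_sub_cancel, add_zero] using h

theorem IsChambollePockSequence.isKKTPoint_of_weak_limit {f : H → EReal} {g : G → EReal}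
    {L : H →L[ℝ] G} {τ σ θ : ℝ} {x : ℕ → H} {y : ℕ → G}
    (hxy : IsChambollePockSequence f g L τ σ θ x y)
    (hf : IsProper f) (hfc : IsConvex f) (hfl : LowerSemicontinuous f)
    (hg : IsProper g) (hgc : IsConvex g) (hgl : LowerSemicontinuous g)
    (hτ : 0 < τ) (hσ : 0 < σ) {U : Ultrafilter ℕ} (hU : (U : Filter ℕ) ≤ atTop) {C : ℝ}
    (hxC : ∀ k, ‖x k‖ ≤ C) (hyC : ∀ k, ‖y k‖ ≤ C)
    (hdx : Tendsto (fun k => x (k + 1) - x k) atTop (𝓝 0))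
    (hdy : Tendsto (fun k => y (k + 1) - y k) atTop (𝓝 0)) {a : H} {b : G}
    (hx : ∀ p, Tendsto (fun k => ⟪p, x k⟫_ℝ) U (𝓝 ⟪p, a⟫_ℝ))
    (hy : ∀ p, Tendsto (fun k => ⟪p, y k⟫_ℝ) U (𝓝 ⟪p, b⟫_ℝ)) :
    IsKKTPoint f g L a b := by
  have hg' := isProper_conj hg hgc hgl
  have hu0 : Tendsto (fun k => τ⁻¹ • (x k - τ • ContinuousLinearMap.adjoint L (y k) - x (k + 1))
      + ContinuousLinearMap.adjoint L (y (k + 1))) U (𝓝 0) := by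
    have h := (((ContinuousLinearMap.adjoint L).continuous.tendsto 0).comp hdy).sub
      (hdx.const_smul τ⁻¹)
    rw [map_zero, smul_zero, sub_zero] at h
    refine (h.mono_left hU).congr fun k => ?_
    simp only [Function.comp_apply, map_sub, smul_sub, inv_smul_smul₀ hτ.ne']
    abel
  have hv0 : Tendsto (fun k => σ⁻¹ • (y k + σ • L (x (k + 1) + θ • (x (k + 1) - x k)) - y (k + 1))
      - L (x (k + 1))) U (𝓝 0) := by
    have h := (((L.continuous.tendsto 0).comp hdx).const_smul θ).sub (hdy.const_smul σ⁻¹)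
    rw [map_zero, smul_zero, smul_zero, sub_zero] at h
    refine (h.mono_left hU).congr fun k => ?_
    simp only [Function.comp_apply, map_add, map_sub, map_smul, smul_sub, smul_add,
      inv_smul_smul₀ hσ.ne']
    abel
  -- Subgradients live at index k + 1, so the shifted sequences are used; vanishing increments keep
  -- their weak limits.
  obtain ⟨h1, h2⟩ := saddle_of_weak_limit L hf hfc hfl hg' (isConvex_conj hg)
    (lowerSemicontinuous_conj hg) (fun k => hxC (k + 1)) (fun k => hyC (k + 1))
    (tendsto_inner_succ hU hdx hx) (tendsto_inner_succ hU hdy hy)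
    (hxy.primal_subgradient hf hfc hfl hτ) (hxy.dual_subgradient hg hgc hgl hσ) hu0 hv0
  exact ⟨h1, h2⟩

end Convergence

end ChambollePock

theorem theorem2
    {H G : Type*}
    [NormedAddCommGroup H] [InnerProductSpace ℝ H] [CompleteSpace H]
    [NormedAddCommGroup G] [InnerProductSpace ℝ G] [CompleteSpace G]
    (f : H → EReal) (hf_proper : ChambollePock.IsProper f)
    (hf_convex : ChambollePock.IsConvex f) (hf_lsc : LowerSemicontinuous f)
    (g : G → EReal) (hg_proper : ChambollePock.IsProper g)
    (hg_convex : ChambollePock.IsConvex g) (hg_lsc : LowerSemicontinuous g)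
    (L : H →L[ℝ] G)
    (hKKT : ∃ (xs : H) (ys : G), ChambollePock.IsKKTPoint f g L xs ys)
    (τ σ θ : ℝ) (hτ : 0 < τ) (hσ : 0 < σ) (hθ_pos : 0 < θ) (hθ_le : θ ≤ 1)
    (hstep : σ * τ * ‖L‖ ^ 2 < 4 * θ * (2 - θ) / (1 - 2 * θ + 9 * θ ^ 2 - 4 * θ ^ 3))
    (x : ℕ → H) (y : ℕ → G)
    (hxy : ChambollePock.IsChambollePockSequence f g L τ σ θ x y) :
    ∃ (xs : H) (ys : G), ChambollePock.IsKKTPoint f g L xs ys ∧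
      ChambollePock.WeaklyConvergesTo
        (fun k => (WithLp.toLp 2 (x k, y k) : WithLp 2 (H × G))) (WithLp.toLp 2 (xs, ys)) := by
  obtain ⟨q, hq⟩ : ∃ q : ℝ, 2 * q = 1 - θ := ⟨(1 - θ) / 2, by ring⟩
  have hq0 : 0 ≤ q := by linarith
  have hq1 : q ≤ 1 := by linarith
  obtain ⟨hsc, β, hqβ, hβ, hcond⟩ :=
    ChambollePock.exists_descent_factor hq (by positivity) hθ_pos hθ_le hstep
  obtain ⟨δ, hδ, hN⟩ :=
    ChambollePock.stepForm_coercive L hτ hσ (sub_nonneg.2 hq1) hsc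
  have fejer : ∀ {xs ys}, ChambollePock.IsKKTPoint f g L xs ys → _ := fun hs =>
    hxy.fejer hf_proper hf_convex hf_lsc hg_proper hg_convex hg_lsc hτ hσ hq hq0 hq1 hqβ hβ
      hcond hδ hN hs
  obtain ⟨x₀, y₀, h₀⟩ := hKKT
  obtain ⟨hW, φ, hφ⟩ := fejer h₀
  obtain ⟨C, hxC, hyC⟩ := ChambollePock.bounded_of_tendsto_stepForm hδ hN hφ
  obtain ⟨hdx, hdy⟩ := ChambollePock.tendsto_zero_of_stepForm hδ hN hW
  have limits : ∀ U : Ultrafilter ℕ, (U : Filter ℕ) ≤ atTop → ∃ xs ys,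
      ChambollePock.IsKKTPoint f g L xs ys ∧
      (∀ p, Tendsto (fun k => ⟪p, x k⟫_ℝ) U (𝓝 ⟪p, xs⟫_ℝ)) ∧
      (∀ p, Tendsto (fun k => ⟪p, y k⟫_ℝ) U (𝓝 ⟪p, ys⟫_ℝ)) := by
    intro U hU
    obtain ⟨xs, hxs⟩ := ChambollePock.exists_weak_limit U hxC
    obtain ⟨ys, hys⟩ := ChambollePock.exists_weak_limit U hyC
    exact ⟨xs, ys, hxy.isKKTPoint_of_weak_limit hf_proper hf_convex hf_lsc hg_proper hg_convex
      hg_lsc hτ hσ hU hxC hyC hdx hdy hxs hys, hxs, hys⟩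
  obtain ⟨xs, ys, hs, hxs, hys⟩ := limits (Ultrafilter.of atTop) (Ultrafilter.of_le _)
  obtain ⟨φs, hφs⟩ := (fejer hs).2
  have unique : ∀ U : Ultrafilter ℕ, (U : Filter ℕ) ≤ atTop →
      (∀ p, Tendsto (fun k => ⟪p, x k⟫_ℝ) U (𝓝 ⟪p, xs⟫_ℝ)) ∧
      (∀ p, Tendsto (fun k => ⟪p, y k⟫_ℝ) U (𝓝 ⟪p, ys⟫_ℝ)) := by
    intro U hU
    obtain ⟨xt, yt, ht, hxt, hyt⟩ := limits U hU
    obtain ⟨φt, hφt⟩ := (fejer ht).2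
    obtain ⟨rfl, rfl⟩ := ChambollePock.weak_limit_unique hδ hN hU (Ultrafilter.of_le _)
      hxt hyt hxs hys hφt hφs
    exact ⟨hxt, hyt⟩
  exact ⟨xs, ys, hs, ChambollePock.weaklyConvergesTo_prod
    (fun p => (tendsto_iff_ultrafilter _ _ _).2 fun U hU => (unique U hU).1 p)
    (fun p => (tendsto_iff_ultrafilter _ _ _).2 fun U hU => (unique U hU).2 p)⟩
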